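/- Let $K$ be a simplicial 2-complex with vertex set $V$ that triangulates an open domain $D\subseteq\mathbb C$ (a nonempty connected open set), i.e. the geometric realization of $K$ is homeomorphic to $D$. Assume that the 1-skeleton of $K$ is recurrent: from every starting vertex, the simple random walk on it almost surely visits every vertex infinitely many times. A label for $K$ is a function $\rho:V\to(0,\infty)$. For a face $\triangle=\langle u,v,w\rangle$ of $K$ put $$\alpha_\rho(v,\triangle)=\arccos\left[\frac{(\rho(v)+\rho(u))^2+(\rho(v)+\rho(w))^2-(\rho(u)+\rho(w))^2}{2(\rho(v)+\rho(u))(\rho(v)+\rho(w))}\right],$$ and let $\Theta_\rho(v)=\sum_{\triangle\ni v}\alpha_\rho(v,\triangle)$, the sum being over the (finitely many) two-dimensional faces of $K$ that contain $v$. Let $\rho$ and $\tilde\rho$ be labels for $K$ such that $K(\tilde\rho)$ is a subpacking for $\Theta_\rho$, that is, $\Theta_{\tilde\rho}(v)\ge\Theta_\rho(v)$ for every $v\in V$. Then the function $A:V\to(0,\infty)$, $A(v)=\tilde\rho(v)/\rho(v)$, is bounded if and only if it is constant. -/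

import Mathlib

open Filter MeasureTheory

noncomputable section

namespace LabelledComplex

/-! ### Simplicial 2-complexes triangulating plane domains -/

section Complexes

variable {V : Type*}

/-- The points of the geometric realization `|K|`, in barycentric coordinates: the nonnegative
functions on the vertices with total mass `1` that are supported in a face of `K`. -/
def Realization (K : AbstractSimplicialComplex V) : Type _ :=
  {x : V → ℝ // (∀ v, 0 ≤ x v) ∧
    ∃ s ∈ K.faces, Function.support x ⊆ (s : Set V) ∧ ∑ v ∈ s, x v = 1}

/-- The closed simplex of `|K|` spanned by the finite vertex set `s`. -/
def ClosedSimplex (K : AbstractSimplicialComplex V) (s : Finset V) : Type _ :=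
  {x : Realization K // Function.support x.1 ⊆ (s : Set V)}

/-- A closed simplex carries the Euclidean topology of its barycentric coordinates. -/
instance (K : AbstractSimplicialComplex V) (s : Finset V) :
    TopologicalSpace (ClosedSimplex K s) :=
  TopologicalSpace.induced (fun x => (x.1.1 : V → ℝ)) inferInstance

/-- The usual (weak, or coherent) topology of the geometric realization: a set is open iff its
trace on every closed simplex of `K` is open. -/
instance (K : AbstractSimplicialComplex V) : TopologicalSpace (Realization K) :=
  ⨆ s : K.faces, TopologicalSpace.coinduced
    (fun x : ClosedSimplex K (s : Finset V) => (x.1 : Realization K)) inferInstance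

/-- `K` is a triangulation of the plane set `D`: it is a complex of dimension at most two whose
geometric realization is homeomorphic to `D`. -/
def IsTriangulationOf (K : AbstractSimplicialComplex V) (D : Set ℂ) : Prop :=
  (∀ s ∈ K.faces, s.card ≤ 3) ∧ Nonempty (Realization K ≃ₜ D)

open Classical in
/-- The 1-skeleton of `K`, as a graph on the vertices of `K`. -/
def oneSkeleton (K : AbstractSimplicialComplex V) : SimpleGraph V where
  Adj u v := u ≠ v ∧ ({u, v} : Finset V) ∈ K.faces
  symm := ⟨fun u v h => ⟨h.1.symm, by rw [Finset.pair_comm]; exact h.2⟩⟩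
  loopless := ⟨fun _ h => h.1 rfl⟩

/-! ### Labels and angle sums -/

/-- A label is a positive function on the vertices. -/
def IsLabel (ρ : V → ℝ) : Prop := ∀ v, 0 < ρ v

open Classical in
/-- The angle at the vertex `v` of the triangle `Δ`, which is laid out in the plane as the triangle
of centers of three mutually externally tangent circles of radii `ρ`. The sums and the product run
over the two vertices of `Δ` other than `v`; see `angle_eq` for the form with named vertices. -/
def angle (ρ : V → ℝ) (v : V) (Δ : Finset V) : ℝ :=
  Real.arccos ((∑ u ∈ Δ.erase v, (ρ v + ρ u) ^ 2 - (∑ u ∈ Δ.erase v, ρ u) ^ 2) /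
    (2 * ∏ u ∈ Δ.erase v, (ρ v + ρ u)))

open Classical in
theorem angle_eq (ρ : V → ℝ) {u v w : V} (huv : u ≠ v) (hvw : v ≠ w) (huw : u ≠ w) :
    angle ρ v {u, v, w} =
      Real.arccos (((ρ v + ρ u) ^ 2 + (ρ v + ρ w) ^ 2 - (ρ u + ρ w) ^ 2) /
        (2 * (ρ v + ρ u) * (ρ v + ρ w))) := by
  have h : ({u, v, w} : Finset V).erase v = {u, w} := by
    ext x
    simp only [Finset.mem_erase, Finset.mem_insert, Finset.mem_singleton]
    grind
  rw [angle, h, Finset.sum_pair huw, Finset.sum_pair huw, Finset.prod_pair huw, mul_assoc]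

/-- The angle sum at `v`: the sum of the angles at `v` of all triangles of `K` that contain `v`
(finitely many when `K` triangulates an open plane set). -/
def angleSum (K : AbstractSimplicialComplex V) (ρ : V → ℝ) (v : V) : ℝ :=
  ∑ᶠ (Δ : Finset V) (_ : Δ ∈ K.faces ∧ Δ.card = 3 ∧ v ∈ Δ), angle ρ v Δ

/-- The labelled complex `K(ρ)` is a subpacking for `Θ`. Angle sums are compared at the interior
vertices; a complex that triangulates an open plane set has no boundary, so these are all of its
vertices. -/
def IsSubpacking (K : AbstractSimplicialComplex V) (ρ : V → ℝ) (Θ : V → ℝ) : Prop :=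
  ∀ v, Θ v ≤ angleSum K ρ v

end Complexes

/-! ### Random walks -/

section Walks

variable {V : Type*}

/-- The infinite sequences of vertices. -/
def PathSpace (V : Type*) : Type _ := ℕ → V

/-- The product σ-algebra, the vertices being discrete. -/
instance (V : Type*) : MeasurableSpace (PathSpace V) :=
  @MeasurableSpace.pi ℕ (fun _ => V) (fun _ => ⊤)

open Classical in
/-- The transition probabilities of the simple random walk: `1 / δ(v)` from `v` to each of its
`δ(v)` neighbours. -/
def simpleTransition (G : SimpleGraph V) (v w : V) : ℝ :=
  if G.Adj v w then 1 / ((G.neighborSet v).ncard : ℝ) else 0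

open Classical in
/-- `μ` is the law of the random walk with transition probabilities `p` started at `a`: it is a
probability measure whose values on cylinders are the products of the transition probabilities
(on countably many vertices there is at most one such measure). -/
def IsWalkLaw (p : V → V → ℝ) (a : V) (μ : Measure (PathSpace V)) : Prop :=
  IsProbabilityMeasure μ ∧ ∀ (n : ℕ) (x : ℕ → V),
    μ.real {ω | ∀ i ≤ n, ω i = x i} =
      (if x 0 = a then 1 else 0) * ∏ i ∈ Finset.range n, p (x i) (x (i + 1))

/-- The random walk is recurrent: whatever its starting vertex, almost surely it visits every
vertex infinitely many times. -/
def IsRecurrentWalk (p : V → V → ℝ) : Prop :=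
  ∀ a, ∃ μ : Measure (PathSpace V), IsWalkLaw p a μ ∧
    ∀ᵐ ω ∂μ, ∀ w, ∃ᶠ n in atTop, ω n = w

/-- A graph is recurrent if its simple random walk is. -/
def IsRecurrentGraph (G : SimpleGraph V) : Prop :=
  IsRecurrentWalk (simpleTransition G)

end Walks

end LabelledComplex

end

/-!
Let `h = log (ρ' / ρ)`. Along the geometric interpolation from `ρ` to `ρ'`, the angle at the vertex
`v` of a triangle varies at the rate `∑ w, r / (ρ v + ρ w) * (h w - h v)`, where `w` runs over the
two other vertices and `r` is the inradius. Integrating over the interpolation and summing over the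
triangles at `v` gives `Θ ρ' v - Θ ρ v = ∑ w, c v w * (h w - h v)` for a network `c` on the
1-skeleton, so that `h` is subharmonic if `K(ρ')` is a subpacking. Since `r ≤ √(ρ v * ρ w)`, each
triangle contributes at most `1 / 2` to the conductance of an edge, and in a plane domain every edge
lies in one or two triangles, so the conductances are positive and bounded. Comparison with unit
conductances (Rayleigh) shows that such a network has null capacity as soon as the simple random
walk is recurrent. By Jacobi's ground state identity, its positive superharmonic functions are then
constant; apply this to `B - h` for a large constant `B`.
-/

noncomputable section

namespace LabelledComplex

/-! ### Invariance of domain in the plane -/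

section Plane

open Metric Topology unitInterval

variable {A : Type*} [TopologicalSpace A]

/-- The function `g` has a continuous logarithm. -/
def HasContinuousLog (g : A → ℂ) : Prop :=
  ∃ L : A → ℂ, Continuous L ∧ ∀ a, Complex.exp (L a) = g a

theorem hasContinuousLog_const {z : ℂ} (hz : z ≠ 0) : HasContinuousLog fun _ : A => z :=
  ⟨fun _ => Complex.log z, continuous_const, fun _ => Complex.exp_log hz⟩

theorem HasContinuousLog.of_homotopy {H : I × A → ℂ} (hH : Continuous H) (hne : ∀ x, H x ≠ 0)
    (h0 : HasContinuousLog fun a => H (0, a)) : HasContinuousLog fun a => H (1, a) := by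
  obtain ⟨L, hL, hexp⟩ := h0
  let H' : C(I × A, {z : ℂ // z ≠ 0}) := ⟨fun x => ⟨H x, hne x⟩, by fun_prop⟩
  have hstart : ∀ a, H' (0, a) = ⟨Complex.exp ((⟨L, hL⟩ : C(A, ℂ)) a), Complex.exp_ne_zero _⟩ :=
    fun a => Subtype.ext (hexp a).symm
  refine ⟨fun a => Complex.isCoveringMap_exp.liftHomotopy H' ⟨L, hL⟩ hstart (1, a), by fun_prop,
    fun a => ?_⟩
  exact congrArg Subtype.val
    (congrFun (Complex.isCoveringMap_exp.liftHomotopy_lifts H' ⟨L, hL⟩ hstart) (1, a))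

/-- If `g = exp L`, then `L (-z) - L z` is a constant odd multiple of `πi`, hence cannot change
sign when `z` is replaced by `-z`. -/
theorem not_hasContinuousLog_of_odd {g : Circle → ℂ} (hodd : ∀ z, g (-z) = -g z) :
    ¬ HasContinuousLog g := by
  rintro ⟨L, hL, hexp⟩
  have hexp_neg : ∀ z, Complex.exp (L (-z)) = -Complex.exp (L z) := fun z => by
    rw [hexp, hexp, hodd]
  have hshift : (fun z => L (-z)) = fun z => L z + (L (-1) - L 1) :=
    Complex.isCoveringMap_exp.eq_of_comp_eq (by fun_prop) (by fun_prop) (by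
      ext z
      simp only [Function.comp, hexp_neg, Complex.exp_add, Complex.exp_sub]
      field_simp [Complex.exp_ne_zero (L 1)]) 1 (by ring)
  have hneg_one := congrFun hshift (-1)
  simp only [neg_neg] at hneg_one
  have heq : L (-1) = L 1 := by linear_combination (-1 / 2) * hneg_one
  have hone := hexp_neg 1
  rw [heq] at hone
  exact Complex.exp_ne_zero (L 1) (by linear_combination (1 / 2) * hone)

theorem HasContinuousLog.of_norm_sub_lt {g h : A → ℂ} (hg : HasContinuousLog g)
    (hgc : Continuous g) (hhc : Continuous h) (hlt : ∀ a, ‖g a - h a‖ < ‖h a‖) :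
    HasContinuousLog h := by
  let H : I × A → ℂ := fun x => h x.2 + (1 - (x.1 : ℝ)) * (g x.2 - h x.2)
  have hne : ∀ x, H x ≠ 0 := fun x hx => by
    have hle : ‖(1 - (x.1 : ℝ) : ℂ)‖ ≤ 1 := by
      rw [← Complex.ofReal_one, ← Complex.ofReal_sub, Complex.norm_real, Real.norm_eq_abs, abs_le]
      constructor <;> linarith [x.1.2.1, x.1.2.2]
    refine (hlt x.2).not_ge ?_
    calc ‖h x.2‖ = ‖(1 - (x.1 : ℝ) : ℂ)‖ * ‖g x.2 - h x.2‖ := by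
          rw [← norm_mul, ← norm_neg (_ * _), ← eq_neg_of_add_eq_zero_left hx]
      _ ≤ ‖g x.2 - h x.2‖ := mul_le_of_le_one_left (norm_nonneg _) hle
  simpa [H] using HasContinuousLog.of_homotopy (H := H) (by fun_prop) hne (by simpa [H] using hg)

section Disc

variable {f : ℂ → ℂ} {c : ℂ} {r : ℝ}

theorem add_mul_circle_mem_closedBall (c : ℂ) (hr : 0 ≤ r) {s : ℝ} (hs : |s| ≤ 1) (z : Circle) :
    c + r * (s * z) ∈ closedBall c r := by
  simpa [abs_of_nonneg hr, Circle.norm_coe z] using mul_le_of_le_one_right hr hs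

theorem continuous_comp_add_mul_circle (hr : 0 ≤ r) (hf : ContinuousOn f (closedBall c r))
    {s : A → ℝ} {z : A → Circle} (hs : Continuous s) (hz : Continuous z) (hle : ∀ x, |s x| ≤ 1) :
    Continuous fun x => f (c + r * (s x * z x)) :=
  hf.comp_continuous (by fun_prop) fun x => add_mul_circle_mem_closedBall c hr (hle x) _

theorem abs_unitInterval_le_one (t : I) : |(t : ℝ)| ≤ 1 := by
  simpa [abs_of_nonneg t.2.1] using t.2.2

theorem hasContinuousLog_sub_of_notMem_image (hr : 0 ≤ r) (hf : ContinuousOn f (closedBall c r))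
    {p : ℂ} (hp : p ∉ f '' closedBall c r) :
    HasContinuousLog fun z : Circle => f (c + r * z) - p := by
  have hne : ∀ w ∈ closedBall c r, f w - p ≠ 0 := fun w hw h => hp ⟨w, hw, sub_eq_zero.1 h⟩
  let H : I × Circle → ℂ := fun x => f (c + r * ((x.1 : ℝ) * x.2)) - p
  have hH : Continuous H := (continuous_comp_add_mul_circle hr hf (by fun_prop) continuous_snd
    fun x => abs_unitInterval_le_one x.1).sub continuous_const
  simpa [H] using HasContinuousLog.of_homotopy hH
    (fun x => hne _ (add_mul_circle_mem_closedBall c hr (abs_unitInterval_le_one x.1) x.2))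
    (by simpa [H] using hasContinuousLog_const (hne c (mem_closedBall_self hr)))

/-- The function is homotopic in `ℂ ∖ {0}` to the odd function `f (c + r z) - f (c - r z)`. -/
theorem not_hasContinuousLog_sub_center (hr : 0 < r) (hf : ContinuousOn f (closedBall c r))
    (hinj : Set.InjOn f (closedBall c r)) :
    ¬ HasContinuousLog fun z : Circle => f (c + r * z) - f c := fun hlog => by
  let H : I × Circle → ℂ := fun x => f (c + r * ((1 : ℝ) * x.2)) - f (c + r * ((-x.1 : ℝ) * x.2))
  have hneg : ∀ t : I, |(-t : ℝ)| ≤ 1 := fun t => by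
    rw [abs_neg]
    exact abs_unitInterval_le_one t
  have hH : Continuous H :=
    (continuous_comp_add_mul_circle hr.le hf continuous_const continuous_snd (by simp)).sub
      (continuous_comp_add_mul_circle hr.le hf (by fun_prop) continuous_snd fun x => hneg x.1)
  have hne : ∀ x, H x ≠ 0 := fun x hx => by
    have heq := hinj (add_mul_circle_mem_closedBall c hr.le (by simp) x.2)
      (add_mul_circle_mem_closedBall c hr.le (hneg x.1) x.2) (sub_eq_zero.1 hx)
    have h1 : (-x.1 : ℝ) = 1 := by simpa [hr.ne', -Complex.ofReal_neg] using heq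
    linarith [x.1.2.1]
  refine not_hasContinuousLog_of_odd (fun z => ?_)
    (HasContinuousLog.of_homotopy hH hne (by simpa [H] using hlog))
  simp [H]

/-- If a point `p` close to `f c` were omitted, then `f - p`, and with it `f - f c`, would have a
continuous logarithm on the boundary circle. -/
theorem image_closedBall_mem_nhds (hr : 0 < r) (hf : ContinuousOn f (closedBall c r))
    (hinj : Set.InjOn f (closedBall c r)) : f '' closedBall c r ∈ 𝓝 (f c) := by
  have hmem : ∀ z : Circle, c + r * z ∈ closedBall c r := fun z => by
    simpa using add_mul_circle_mem_closedBall c hr.le (s := 1) (by simp) z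
  have hfc : Continuous fun z : Circle => f (c + r * z) := hf.comp_continuous (by fun_prop) hmem
  obtain ⟨z₀, hz₀⟩ := (isCompact_univ (X := Circle)).exists_isMinOn Set.univ_nonempty
    (hfc.sub (continuous_const (y := f c))).norm.continuousOn
  have hpos : 0 < ‖f (c + r * z₀) - f c‖ := norm_pos_iff.2 fun h => by
    simpa [hr.ne'] using hinj (hmem z₀) (mem_closedBall_self hr.le) (sub_eq_zero.1 h)
  refine Metric.mem_nhds_iff.2 ⟨_, hpos, fun p hp => ?_⟩
  by_contra hpf
  refine not_hasContinuousLog_sub_center hr hf hinj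
    ((hasContinuousLog_sub_of_notMem_image hr.le hf hpf).of_norm_sub_lt (hfc.sub continuous_const)
      (hfc.sub continuous_const) fun z => ?_)
  rw [sub_sub_sub_cancel_left, ← dist_eq_norm, dist_comm]
  exact (mem_ball.1 hp).trans_le (hz₀.2 (Set.mem_univ z))

end Disc

theorem isOpen_image_of_injOn {f : ℂ → ℂ} {U : Set ℂ} (hU : IsOpen U) (hf : ContinuousOn f U)
    (hinj : Set.InjOn f U) : IsOpen (f '' U) := by
  rw [isOpen_iff_mem_nhds]
  rintro _ ⟨c, hc, rfl⟩
  obtain ⟨r, hr, hball⟩ := nhds_basis_closedBall.mem_iff.1 (hU.mem_nhds hc)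
  exact mem_of_superset (image_closedBall_mem_nhds hr (hf.mono hball) (hinj.mono hball))
    (Set.image_mono hball)

theorem isOpenMap_of_injective {e f : A → ℂ} (he : IsOpenEmbedding e) (hf : Continuous f)
    (hinj : Function.Injective f) : IsOpenMap f := by
  intro W hW
  rcases isEmpty_or_nonempty A with _ | _
  · simp [Set.eq_empty_of_isEmpty]
  have hleft : ∀ x, Function.invFun e (e x) = x := Function.leftInverse_invFun he.injective
  have himage : (f ∘ Function.invFun e) '' (e '' W) = f '' W := by
    simp only [Set.image_image, Function.comp, hleft]
  rw [← himage]
  refine isOpen_image_of_injOn (he.isOpenMap W hW) ?_ ?_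
  · rintro _ ⟨x, -, rfl⟩
    refine ContinuousAt.continuousWithinAt ((he.continuousAt_iff).1 ?_)
    simpa only [Function.comp_def, hleft] using hf.continuousAt
  · rintro _ ⟨x, -, rfl⟩ _ ⟨y, -, rfl⟩ h
    simp only [Function.comp, hleft] at h
    rw [hinj h]

theorem not_injective_real [Nonempty A] {e : A → ℂ} (he : IsOpenEmbedding e) {f : A → ℝ}
    (hf : Continuous f) : ¬ Function.Injective f := fun hinj => by
  have hopen : IsOpen (Set.range fun x => (f x : ℂ)) :=
    (isOpenMap_of_injective he (Complex.continuous_ofReal.comp hf)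
      (Complex.ofReal_injective.comp hinj)).isOpen_range
  have hsub : (Set.range fun x => (f x : ℂ)) ⊆ {z | z.im < 0} := by
    rw [← Complex.interior_setOfPred_im_le]
    refine interior_maximal ?_ hopen
    rintro _ ⟨x, rfl⟩
    simp
  obtain ⟨x⟩ := ‹Nonempty A›
  simpa using hsub ⟨x, rfl⟩

end Plane

/-! ### The triangles at an edge of a triangulated plane domain -/

section EdgeTriangles

open Metric Topology

variable {V : Type*} {K : AbstractSimplicialComplex V}

theorem continuous_realization_dom {X : Type*} [TopologicalSpace X] {g : Realization K → X}
    (h : ∀ s ∈ K.faces, Continuous fun x : ClosedSimplex K s => g x.1) : Continuous g := by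
  rw [continuous_iSup_dom]
  intro s
  rw [continuous_coinduced_dom]
  exact h s s.2

theorem continuous_coord (v : V) : Continuous fun x : Realization K => x.1 v :=
  continuous_realization_dom fun _ _ => (continuous_apply v).comp continuous_induced_dom

theorem continuous_to_realization {X : Type*} [TopologicalSpace X] {s : Finset V}
    (hs : s ∈ K.faces) {φ : X → Realization K} (hφ : ∀ x, Function.support (φ x).1 ⊆ (s : Set V))
    (hc : ∀ v, Continuous fun x => (φ x).1 v) : Continuous φ := by
  let i : X → ClosedSimplex K s := fun x => ⟨φ x, hφ x⟩
  have hi : Continuous i := continuous_induced_rng.2 (continuous_pi hc)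
  have hval : Continuous fun x : ClosedSimplex K s => (x.1 : Realization K) :=
    continuous_iff_coinduced_le.2 (le_iSup (fun s : K.faces => TopologicalSpace.coinduced
      (fun x : ClosedSimplex K (s : Finset V) => (x.1 : Realization K)) inferInstance) ⟨s, hs⟩)
  exact hval.comp hi

theorem exists_face_eq_support (x : Realization K) :
    ∃ s ∈ K.faces, Function.support x.1 = s ∧ ∑ v ∈ s, x.1 v = 1 := by
  classical
  obtain ⟨-, s, hs, hsub, hsum⟩ := x.2
  have hsum' : ∑ v ∈ s with x.1 v ≠ 0, x.1 v = 1 := (Finset.sum_filter_ne_zero s).trans hsum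
  refine ⟨s.filter (x.1 · ≠ 0), (K.isRelLowerSet_faces hs).2 (Finset.filter_subset _ _) ?_, ?_,
    hsum'⟩
  · exact Finset.nonempty_of_sum_ne_zero (hsum'.trans_ne one_ne_zero)
  · ext v
    simpa using fun hv => hsub hv

theorem exists_realization_pos {s : Finset V} (hs : s ∈ K.faces) :
    ∃ x : Realization K, ∀ v ∈ s, 0 < x.1 v := by
  classical
  have hcard : 0 < (s.card : ℝ) := mod_cast (K.isRelLowerSet_faces hs).1.card_pos
  refine ⟨⟨fun v => if v ∈ s then (s.card : ℝ)⁻¹ else 0, fun v => by positivity, s, hs, ?_, ?_⟩,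
    fun v hv => by simpa [hv] using hcard⟩
  · exact fun v hv => by simpa using (ite_ne_right_iff.1 hv).1
  · rw [Finset.sum_ite_of_true fun _ => id]
    simp [hcard.ne']

/-- The triangles of `K` that contain the vertices `v ≠ w`. -/
def edgeTriangles (K : AbstractSimplicialComplex V) (v w : V) : Set (Finset V) :=
  {Δ | Δ ∈ K.faces ∧ Δ.card = 3 ∧ v ∈ Δ ∧ w ∈ Δ ∧ v ≠ w}

theorem edgeTriangles_comm (v w : V) : edgeTriangles K v w = edgeTriangles K w v := by
  ext Δ
  simp only [edgeTriangles, Set.mem_ofPred_eq, ne_comm (a := v)]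
  tauto

theorem oneSkeleton_adj_of_mem {s : Finset V} (hs : s ∈ K.faces) {v w : V} (hv : v ∈ s)
    (hw : w ∈ s) (hvw : v ≠ w) : (oneSkeleton K).Adj v w := by
  classical
  exact ⟨hvw, (K.isRelLowerSet_faces hs).2 (by simp [Finset.insert_subset_iff, hv, hw]) (by simp)⟩

theorem exists_eq_triple [DecidableEq V] {Δ : Finset V} (hcard : Δ.card = 3) {v w : V} (hv : v ∈ Δ)
    (hw : w ∈ Δ) (hvw : v ≠ w) : ∃ u, v ≠ u ∧ w ≠ u ∧ Δ = {v, w, u} := by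
  have hw' : w ∈ Δ.erase v := Finset.mem_erase.2 ⟨hvw.symm, hw⟩
  have hone : ((Δ.erase v).erase w).card = 1 := by
    rw [Finset.card_erase_of_mem hw', Finset.card_erase_of_mem hv, hcard]
  obtain ⟨u, hu⟩ := Finset.card_eq_one.1 hone
  have hmem : u ∈ (Δ.erase v).erase w := hu ▸ Finset.mem_singleton_self u
  simp only [Finset.mem_erase] at hmem
  refine ⟨u, hmem.2.1.symm, hmem.1.symm, ?_⟩
  rw [← hu, Finset.insert_erase hw', Finset.insert_erase hv]

theorem face_eq_pair [DecidableEq V] {a b : V} (hne : a ≠ b) (hno : edgeTriangles K a b = ∅)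
    {s : Finset V} (hs : s ∈ K.faces) (ha : a ∈ s) (hb : b ∈ s) : s = {a, b} := by
  refine (Finset.Subset.antisymm ?_ fun c hc => ?_).symm
  · simp [Finset.insert_subset_iff, ha, hb]
  by_contra hcab
  simp only [Finset.mem_insert, Finset.mem_singleton, not_or] at hcab
  have hface : ({a, b, c} : Finset V) ∈ K.faces :=
    (K.isRelLowerSet_faces hs).2 (by simp [Finset.insert_subset_iff, ha, hb, hc]) (by simp)
  have hcard : ({a, b, c} : Finset V).card = 3 :=
    Finset.card_eq_three.2 ⟨a, b, c, hne, Ne.symm hcab.1, Ne.symm hcab.2, rfl⟩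
  exact Set.eq_empty_iff_forall_notMem.1 hno _ ⟨hface, hcard, by simp, by simp, hne⟩

/-- Near the midpoint of an edge in no triangle, `|K|` would be a line. -/
theorem edgeTriangles_nonempty {e : Realization K → ℂ} (he : IsOpenEmbedding e) {a b : V}
    (hab : (oneSkeleton K).Adj a b) : (edgeTriangles K a b).Nonempty := by
  classical
  obtain ⟨hne, hface⟩ := hab
  by_contra hno
  rw [Set.not_nonempty_iff_eq_empty] at hno
  let U : Set (Realization K) := {x | 0 < x.1 a ∧ 0 < x.1 b}
  have hU : IsOpen U := (isOpen_lt continuous_const (continuous_coord a)).inter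
    (isOpen_lt continuous_const (continuous_coord b))
  have hcoord : ∀ x ∈ U, x.1 a + x.1 b = 1 ∧ ∀ v, v ≠ a → v ≠ b → x.1 v = 0 := fun x hx => by
    obtain ⟨s, hs, hsupp, hsum⟩ := exists_face_eq_support x
    have hmem : ∀ v, x.1 v ≠ 0 ↔ v ∈ s := fun v => by
      rw [← Function.mem_support, hsupp, Finset.mem_coe]
    obtain rfl := face_eq_pair hne hno hs ((hmem a).1 hx.1.ne') ((hmem b).1 hx.2.ne')
    rw [Finset.sum_pair hne] at hsum
    exact ⟨hsum, fun v hva hvb => by simpa [hva, hvb] using hmem v⟩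
  have hinj : Function.Injective fun x : U => x.1.1 a := fun x y hxy => by
    obtain ⟨hx, hx0⟩ := hcoord x x.2
    obtain ⟨hy, hy0⟩ := hcoord y y.2
    refine Subtype.ext (Subtype.ext (funext fun v => ?_))
    by_cases hva : v = a
    · exact hva ▸ hxy
    by_cases hvb : v = b
    · subst hvb
      linarith [show x.1.1 a = y.1.1 a from hxy]
    rw [hx0 v hva hvb, hy0 v hva hvb]
  obtain ⟨m, hm⟩ := exists_realization_pos hface
  have : Nonempty U := ⟨⟨m, hm a (by simp), hm b (by simp)⟩⟩
  exact not_injective_real (he.comp hU.isOpenEmbedding_subtypeVal)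
    ((continuous_coord a).comp continuous_subtype_val) hinj

open Classical in
/-- The triangles `{a, b, c}` and `{a, b, d}` of `K` form a book with two pages and spine
`{a, b}`. -/
structure IsBook (K : AbstractSimplicialComplex V) (a b c d : V) : Prop where
  upper : {a, b, c} ∈ K.faces
  lower : {a, b, d} ∈ K.faces
  nodup : [a, b, c, d].Nodup

open Classical in
/-- Barycentric coordinates on a book, laid out over the open unit disc with the spine `{a, b}`
along the real axis, the page of `c` in the upper and the page of `d` in the lower half-plane. -/
def bookCoord (a b c d : V) (z : ℂ) (v : V) : ℝ :=
  if v = a then 1 / 2 - |z.im| / 4 + z.re / 4 else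
  if v = b then 1 / 2 - |z.im| / 4 - z.re / 4 else
  if v = c then max z.im 0 / 2 else
  if v = d then max (-z.im) 0 / 2 else 0

theorem continuous_bookCoord (a b c d v : V) : Continuous fun z => bookCoord a b c d z v := by
  unfold bookCoord
  split_ifs <;> fun_prop

theorem bookCoord_nonneg (a b c d : V) {z : ℂ} (hz : z ∈ ball (0 : ℂ) 1) (v : V) :
    0 ≤ bookCoord a b c d z v := by
  have hnorm : ‖z‖ ≤ 1 := by simpa using (mem_ball.1 hz).le
  have hre := abs_le.1 ((Complex.abs_re_le_norm z).trans hnorm)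
  have him := (Complex.abs_im_le_norm z).trans hnorm
  unfold bookCoord
  split_ifs
  · linarith
  · linarith
  all_goals positivity

open Classical in
theorem support_bookCoord_subset (a b c d : V) {z : ℂ} (hz : 0 ≤ z.im) :
    Function.support (bookCoord a b c d z) ⊆ (({a, b, c} : Finset V) : Set V) := by
  intro v
  simp only [Function.mem_support, bookCoord, max_eq_right (neg_nonpos.2 hz), Finset.coe_insert,
    Finset.coe_singleton, Set.mem_insert_iff, Set.mem_singleton_iff]
  split_ifs <;> simp_all

namespace IsBook

variable {a b c d : V}

theorem swap (h : IsBook K a b c d) : IsBook K a b d c :=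
  ⟨h.lower, h.upper, by have := h.nodup; simp at this ⊢; tauto⟩

theorem bookCoord_swap (h : IsBook K a b c d) (z : ℂ) :
    bookCoord a b c d z = bookCoord a b d c (starRingEnd ℂ z) := by
  have hnodup := h.nodup
  funext v
  unfold bookCoord
  simp only [Complex.conj_im, Complex.conj_re, abs_neg, neg_neg]
  split_ifs <;> simp_all

open Classical in
theorem sum_bookCoord (h : IsBook K a b c d) {z : ℂ} (hz : 0 ≤ z.im) :
    ∑ v ∈ {a, b, c}, bookCoord a b c d z v = 1 := by
  have hnodup := h.nodup
  simp only [List.nodup_cons, List.mem_cons, List.not_mem_nil, or_false, not_or] at hnodup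
  rw [Finset.sum_insert (by simp [hnodup]), Finset.sum_pair hnodup.2.1.1]
  simp only [bookCoord, if_true, if_neg (Ne.symm hnodup.1.1), if_neg (Ne.symm hnodup.1.2.1),
    if_neg (Ne.symm hnodup.2.1.1), abs_of_nonneg hz, max_eq_left hz]
  ring

theorem bookCoord_mem (h : IsBook K a b c d) {z : ℂ} (hz : z ∈ ball (0 : ℂ) 1) :
    (∀ v, 0 ≤ bookCoord a b c d z v) ∧ ∃ s ∈ K.faces,
      Function.support (bookCoord a b c d z) ⊆ (s : Set V) ∧
        ∑ v ∈ s, bookCoord a b c d z v = 1 := by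
  refine ⟨bookCoord_nonneg a b c d hz, ?_⟩
  rcases le_total 0 z.im with him | him
  · exact ⟨_, h.upper, support_bookCoord_subset a b c d him, h.sum_bookCoord him⟩
  · have him' : 0 ≤ (starRingEnd ℂ z).im := by simpa using him
    rw [h.bookCoord_swap]
    exact ⟨_, h.lower, support_bookCoord_subset a b d c him', h.swap.sum_bookCoord him'⟩

/-- The book as a topological disc in `|K|`. -/
def toRealization (h : IsBook K a b c d) (z : ball (0 : ℂ) 1) : Realization K :=
  ⟨bookCoord a b c d z, h.bookCoord_mem z.2⟩

theorem toRealization_injective (h : IsBook K a b c d) : Function.Injective h.toRealization := by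
  intro z w hzw
  have hnodup := h.nodup
  simp only [List.nodup_cons, List.mem_cons, List.not_mem_nil, or_false, not_or] at hnodup
  have hcoord : ∀ v, bookCoord a b c d z v = bookCoord a b c d w v :=
    congrFun (congrArg Subtype.val hzw)
  have ha := hcoord a
  have hb := hcoord b
  have hc := hcoord c
  have hd := hcoord d
  simp only [bookCoord, if_true, if_neg (Ne.symm hnodup.1.1), if_neg (Ne.symm hnodup.1.2.1),
    if_neg (Ne.symm hnodup.1.2.2), if_neg (Ne.symm hnodup.2.1.1), if_neg (Ne.symm hnodup.2.1.2),
    if_neg (Ne.symm hnodup.2.2.1)] at ha hb hc hd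
  refine Subtype.ext (Complex.ext (by linarith) ?_)
  linarith [max_zero_sub_max_neg_zero_eq_self (z : ℂ).im,
    max_zero_sub_max_neg_zero_eq_self (w : ℂ).im]

theorem continuous_toRealization (h : IsBook K a b c d) : Continuous h.toRealization := by
  have hcover : {z : ball (0 : ℂ) 1 | 0 ≤ (z : ℂ).im} ∪ {z | (z : ℂ).im ≤ 0} = Set.univ :=
    Set.eq_univ_of_forall fun z => le_total 0 (z : ℂ).im
  rw [← continuousOn_univ, ← hcover]
  refine ContinuousOn.union_of_isClosed ?_ ?_ (isClosed_le (by fun_prop) (by fun_prop))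
    (isClosed_le (by fun_prop) (by fun_prop))
  all_goals rw [continuousOn_iff_continuous_domRestrict]
  · refine continuous_to_realization h.upper (fun z => support_bookCoord_subset a b c d z.2)
      fun v => (continuous_bookCoord a b c d v).comp (by fun_prop)
  · refine continuous_to_realization h.lower (fun z => ?_)
      fun v => (continuous_bookCoord a b c d v).comp (by fun_prop)
    have hz : (z : ℂ).im ≤ 0 := z.2
    change Function.support (bookCoord a b c d z) ⊆ _
    rw [h.bookCoord_swap]
    exact support_bookCoord_subset a b d c (by simpa using hz)

theorem isOpen_range_toRealization (h : IsBook K a b c d) {g : Realization K → ℂ}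
    (hg : Continuous g) (hinj : Function.Injective g) : IsOpen (Set.range h.toRealization) := by
  have hopen : IsOpen (Set.range (g ∘ h.toRealization)) :=
    (isOpenMap_of_injective (isOpen_ball (x := (0 : ℂ)) (ε := 1)).isOpenEmbedding_subtypeVal
      (hg.comp h.continuous_toRealization) (hinj.comp h.toRealization_injective)).isOpen_range
  rw [← hinj.preimage_image (Set.range h.toRealization), ← Set.range_comp]
  exact hopen.preimage hg

end IsBook

open Classical in
/-- The two books with pages `c, d` and `e, c` would both be neighbourhoods of the midpoint of
`{a, b}`, but the page of `e` does not meet the first book off the edge. -/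
theorem not_three_triangles {g : Realization K → ℂ} (hg : Continuous g)
    (hinj : Function.Injective g) {a b c d e : V} (hnodup : [a, b, c, d, e].Nodup)
    (hc : {a, b, c} ∈ K.faces) (hd : {a, b, d} ∈ K.faces) : {a, b, e} ∉ K.faces := fun he => by
  simp only [List.nodup_cons, List.mem_cons, List.not_mem_nil, or_false, not_or] at hnodup
  have hcd : IsBook K a b c d := ⟨hc, hd, by simp [hnodup]⟩
  have hec : IsBook K a b e c := ⟨he, hc, by simp [hnodup, Ne.symm hnodup.2.2.1.2]⟩
  let S : Set ℂ := Subtype.val '' (hec.toRealization ⁻¹' Set.range hcd.toRealization)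
  have hS : IsOpen S := isOpen_ball.isOpenMap_subtype_val _
    ((hcd.isOpen_range_toRealization hg hinj).preimage hec.continuous_toRealization)
  have hsub : S ⊆ {z | z.im ≤ 0} := by
    rintro _ ⟨z, ⟨w, hw⟩, rfl⟩
    have hcoord : bookCoord a b c d w e = bookCoord a b e c z e :=
      congrFun (congrArg Subtype.val hw) e
    have hmax : (0 : ℝ) = max (z : ℂ).im 0 / 2 := by
      simpa [bookCoord, Ne.symm hnodup.1.2.2.2, Ne.symm hnodup.2.1.2.2, Ne.symm hnodup.2.2.1.2,
        Ne.symm hnodup.2.2.2.1] using hcoord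
    have hle : (z : ℂ).im ≤ max (z : ℂ).im 0 := le_max_left _ _
    exact hle.trans (by linarith)
  have hzero : (0 : ℂ) ∈ S := by
    refine ⟨⟨0, by simp⟩, ⟨⟨0, by simp⟩, Subtype.ext (funext fun v => ?_)⟩, rfl⟩
    simp [IsBook.toRealization, bookCoord]
  have hneg : (0 : ℂ) ∈ {z : ℂ | z.im < 0} :=
    Complex.interior_setOfPred_im_le 0 ▸ interior_maximal hsub hS hzero
  simp at hneg

theorem encard_edgeTriangles_le_two {g : Realization K → ℂ} (hg : Continuous g)
    (hinj : Function.Injective g) (a b : V) : (edgeTriangles K a b).encard ≤ 2 := by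
  classical
  by_contra! hcard
  obtain ⟨T, hT, hT3⟩ := Set.exists_subset_encard_eq (Order.add_one_le_of_lt hcard)
  obtain ⟨s, t, u, hst, hsu, htu, rfl⟩ := Set.encard_eq_three.1 hT3
  simp only [Set.insert_subset_iff, Set.singleton_subset_iff] at hT
  obtain ⟨hs, ht, hu⟩ := hT
  have htriple : ∀ s ∈ edgeTriangles K a b, ∃ c, a ≠ c ∧ b ≠ c ∧ s = {a, b, c} :=
    fun s ⟨_, h3, ha, hb, hab⟩ => exists_eq_triple h3 ha hb hab
  obtain ⟨c, hac, hbc, rfl⟩ := htriple s hs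
  obtain ⟨d, had, hbd, rfl⟩ := htriple t ht
  obtain ⟨e, hae, hbe, rfl⟩ := htriple u hu
  have hne : c ≠ d ∧ c ≠ e ∧ d ≠ e :=
    ⟨fun h => hst (h ▸ rfl), fun h => hsu (h ▸ rfl), fun h => htu (h ▸ rfl)⟩
  refine not_three_triangles hg hinj ?_ hs.1 ht.1 hu.1
  simp [hs.2.2.2.2, hac, hbc, had, hbd, hae, hbe, hne]

theorem IsTriangulationOf.exists_isOpenEmbedding {D : Set ℂ} (hK : IsTriangulationOf K D)
    (hD : IsOpen D) : ∃ e : Realization K → ℂ, IsOpenEmbedding e :=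
  let ⟨Ψ⟩ := hK.2
  ⟨Subtype.val ∘ Ψ, hD.isOpenEmbedding_subtypeVal.comp Ψ.isOpenEmbedding⟩

end EdgeTriangles

/-! ### Recurrent walks -/

section Walks

variable {V : Type*} {p : V → V → ℝ} {G : SimpleGraph V} {a : V} {μ : Measure (PathSpace V)}

theorem IsRecurrentWalk.countable (h : IsRecurrentWalk p) : Countable V := by
  rcases isEmpty_or_nonempty V with _ | ⟨⟨a⟩⟩
  · infer_instance
  obtain ⟨μ, ⟨hprob, -⟩, hvisit⟩ := h a
  obtain ⟨ω, hω⟩ := hvisit.exists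
  exact (show Function.Surjective ω from fun w => (hω w).exists).countable

theorem measurableSet_apply_eq (n : ℕ) (v : V) : MeasurableSet {ω : PathSpace V | ω n = v} :=
  @measurable_pi_apply ℕ (fun _ => V) (fun _ => ⊤) n {v} trivial

theorem measureReal_eq_tsum_prefix [Countable V] [IsFiniteMeasure μ] (n : ℕ)
    {s : Set (PathSpace V)} (hs : MeasurableSet s) :
    μ.real s = ∑' y : Fin n → V, μ.real (s ∩ {ω | ∀ i : Fin n, ω i = y i}) := by
  have hprefix : ∀ y : Fin n → V, MeasurableSet {ω : PathSpace V | ∀ i : Fin n, ω i = y i} :=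
    fun y => by
      simp only [Set.ofPred_forall]
      exact MeasurableSet.iInter fun i => measurableSet_apply_eq i (y i)
  have hcover : s = ⋃ y : Fin n → V, s ∩ {ω | ∀ i : Fin n, ω i = y i} := by
    rw [← Set.inter_iUnion, Set.inter_eq_left.2]
    exact fun ω _ => Set.mem_iUnion.2 ⟨fun i => ω i, fun _ => rfl⟩
  have hdisj : Pairwise (Function.onFun Disjoint fun y : Fin n → V =>
      s ∩ {ω | ∀ i : Fin n, ω i = y i}) := fun y z hyz =>
    Set.disjoint_left.2 fun ω hy hz => hyz (funext fun i => (hy.2 i).symm.trans (hz.2 i))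
  nth_rw 1 [hcover]
  rw [measureReal_def, measure_iUnion hdisj fun y => hs.inter (hprefix y),
    ENNReal.tsum_toReal_eq fun _ => measure_ne_top _ _]
  rfl

namespace IsWalkLaw

theorem measureReal_start (h : IsWalkLaw p a μ) (v : V) [Decidable (v = a)] :
    μ.real {ω | ω 0 = v} = if v = a then 1 else 0 := by
  convert h.2 0 fun _ => v using 1
  · simp
  · simp

theorem ae_start (h : IsWalkLaw p a μ) : ∀ᵐ ω ∂μ, ω 0 = a := by
  classical
  have := h.1
  refine (mem_ae_iff_prob_eq_one (measurableSet_apply_eq 0 a)).2 ?_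
  rw [← ENNReal.toReal_eq_one_iff]
  exact (h.measureReal_start a).trans (if_pos rfl)

theorem measureReal_prefix_succ (h : IsWalkLaw p a μ) {n : ℕ} (y : Fin (n + 1) → V) (w : V) :
    μ.real {ω | (∀ i : Fin (n + 1), ω i = y i) ∧ ω (n + 1) = w} =
      μ.real {ω | ∀ i : Fin (n + 1), ω i = y i} * p (y (Fin.last n)) w := by
  let x : ℕ → V := fun i => if hi : i ≤ n then y ⟨i, Nat.lt_succ_of_le hi⟩ else w
  have hprefix : ∀ ω : PathSpace V, (∀ i : Fin (n + 1), ω i = y i) ↔ ∀ i ≤ n, ω i = x i := fun ω =>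
    ⟨fun hω i hi => by simpa [x, hi] using hω ⟨i, Nat.lt_succ_of_le hi⟩,
      fun hω i => by simpa [x, Nat.le_of_lt_succ i.2] using hω i (Nat.le_of_lt_succ i.2)⟩
  have hsucc : ∀ ω : PathSpace V,
      ((∀ i ≤ n, ω i = x i) ∧ ω (n + 1) = w) ↔ ∀ i ≤ n + 1, ω i = x i := fun ω => by
    simp [Nat.le_succ_iff, or_imp, forall_and, x]
  simp only [hprefix, hsucc, h.2, Finset.prod_range_succ, mul_assoc]
  simp [x, Fin.last]

theorem measureReal_succ [Countable V] (h : IsWalkLaw p a μ) (n : ℕ) (v w : V) :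
    μ.real {ω | ω n = v ∧ ω (n + 1) = w} = μ.real {ω | ω n = v} * p v w := by
  have := h.1
  rw [measureReal_eq_tsum_prefix (n + 1) (measurableSet_apply_eq n v), ← tsum_mul_right]
  refine (measureReal_eq_tsum_prefix (n + 1)
    ((measurableSet_apply_eq n v).inter (measurableSet_apply_eq (n + 1) w))).trans ?_
  refine tsum_congr fun y => ?_
  have hlast : ∀ ω : PathSpace V, (∀ i : Fin (n + 1), ω i = y i) → ω n = y (Fin.last n) :=
    fun ω hω => hω (Fin.last n)
  by_cases hv : y (Fin.last n) = v
  · subst hv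
    convert h.measureReal_prefix_succ y w using 2
    · ext ω
      exact ⟨fun hω => ⟨hω.2, hω.1.2⟩, fun hω => ⟨⟨hlast ω hω.1, hω.2⟩, hω.1⟩⟩
    · congr 1
      ext ω
      exact ⟨fun hω => hω.2, fun hω => ⟨hlast ω hω, hω⟩⟩
  · have hempty : ∀ s : Set (PathSpace V), s ⊆ {ω | ω n = v} →
        s ∩ {ω | ∀ i : Fin (n + 1), ω i = y i} = ∅ := fun s hs =>
      Set.eq_empty_of_forall_notMem fun ω hω => hv ((hlast ω hω.2).symm.trans (hs hω.1))
    rw [hempty _ subset_rfl, hempty _ fun ω hω => hω.1, measureReal_empty, zero_mul]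

theorem ae_transition_ne_zero [Countable V] (h : IsWalkLaw p a μ) :
    ∀ᵐ ω ∂μ, ∀ n, p (ω n) (ω (n + 1)) ≠ 0 := by
  have := h.1
  have hpair : ∀ᵐ ω ∂μ, ∀ n v w, p v w = 0 → ¬ (ω n = v ∧ ω (n + 1) = w) := by
    simp only [ae_all_iff]
    intro n v w hp
    have hnull : μ {ω | ω n = v ∧ ω (n + 1) = w} = 0 := by
      rw [← measureReal_eq_zero_iff, h.measureReal_succ, hp, mul_zero]
    exact measure_eq_zero_iff_ae_notMem.1 hnull
  filter_upwards [hpair] with ω hω n hp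
  exact hω n _ _ hp ⟨rfl, rfl⟩

theorem ae_adj [Countable V] (h : IsWalkLaw (simpleTransition G) a μ) :
    ∀ᵐ ω ∂μ, ∀ n, G.Adj (ω n) (ω (n + 1)) := by
  filter_upwards [h.ae_transition_ne_zero] with ω hω n
  classical
  exact (ite_ne_right_iff.1 (hω n)).1

theorem measureReal_apply_succ [Countable V] [G.LocallyFinite]
    (h : IsWalkLaw (simpleTransition G) a μ) (n : ℕ) (v : V) :
    μ.real {ω | ω (n + 1) = v} = ∑ w ∈ G.neighborFinset v, μ.real {ω | ω n = w} / G.degree w := by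
  have := h.1
  have hae : {ω | ω (n + 1) = v} =ᵐ[μ]
      ⋃ w ∈ G.neighborFinset v, {ω | ω n = w ∧ ω (n + 1) = v} := by
    filter_upwards [h.ae_adj] with ω hω
    have hadj := hω n
    refine propext ⟨fun hv => ?_, fun hv => ?_⟩
    · have hv : ω (n + 1) = v := hv
      exact Set.mem_biUnion (x := ω n) (by simpa [hv] using hadj.symm) ⟨rfl, hv⟩
    · obtain ⟨w, -, -, hv⟩ := Set.mem_iUnion₂.1 hv
      exact hv
  rw [measureReal_congr hae, measureReal_biUnion_finset]
  · refine Finset.sum_congr rfl fun w hw => ?_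
    rw [SimpleGraph.mem_neighborFinset] at hw
    rw [h.measureReal_succ, simpleTransition, if_pos hw.symm, mul_one_div,
      Set.ncard_eq_toFinset_card', SimpleGraph.degree, SimpleGraph.neighborFinset]
  · exact fun v _ w _ hvw => Set.disjoint_left.2 fun ω hv hw => hvw (hv.1.symm.trans hw.1)
  · exact fun w _ => (measurableSet_apply_eq n w).inter (measurableSet_apply_eq (n + 1) v)

theorem finite_support_measureReal [Countable V] [G.LocallyFinite]
    (h : IsWalkLaw (simpleTransition G) a μ) (n : ℕ) :
    (Function.support fun v => μ.real {ω | ω n = v}).Finite := by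
  classical
  induction n with
  | zero =>
    refine (Set.finite_singleton a).subset fun v hv => ?_
    simpa [h.measureReal_start] using hv
  | succ n ih =>
    refine (ih.biUnion fun w _ => (G.neighborFinset w).finite_toSet).subset fun v hv => ?_
    rw [Function.mem_support, h.measureReal_apply_succ] at hv
    obtain ⟨w, hw, hne⟩ := Finset.exists_ne_zero_of_sum_ne_zero hv
    refine Set.mem_biUnion (x := w) (div_ne_zero_iff.1 hne).1 ?_
    simpa using ((G.mem_neighborFinset v w).1 hw).symm

end IsWalkLaw

namespace IsRecurrentGraph

theorem exists_adj (h : IsRecurrentGraph G) (v : V) : ∃ w, G.Adj v w := by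
  have := IsRecurrentWalk.countable h
  obtain ⟨μ, hμ, -⟩ := h v
  have := hμ.1
  obtain ⟨ω, h0, hadj⟩ := (hμ.ae_start.and hμ.ae_adj).exists
  exact ⟨ω 1, by simpa [h0] using hadj 0⟩

theorem neighborSet_finite (h : IsRecurrentGraph G) (v : V) : (G.neighborSet v).Finite := by
  have := IsRecurrentWalk.countable h
  obtain ⟨μ, hμ, -⟩ := h v
  have := hμ.1
  obtain ⟨ω, h0, hne⟩ := (hμ.ae_start.and hμ.ae_transition_ne_zero).exists
  refine Set.finite_of_ncard_ne_zero fun hcard => hne 0 ?_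
  simp [simpleTransition, h0, hcard]

theorem reachable (h : IsRecurrentGraph G) (a v : V) : G.Reachable a v := by
  have := IsRecurrentWalk.countable h
  obtain ⟨μ, hμ, hvisit⟩ := h a
  have := hμ.1
  obtain ⟨ω, ⟨h0, hadj⟩, hω⟩ := ((hμ.ae_start.and hμ.ae_adj).and hvisit).exists
  obtain ⟨n, rfl⟩ := (hω v).exists
  induction n with
  | zero => rw [h0]
  | succ n ih => exact ih.trans (hadj n).reachable

end IsRecurrentGraph

theorem not_summable_measureReal [IsFiniteMeasure μ] {v : V}
    (hvisit : ∀ᵐ ω ∂μ, ∃ᶠ n in atTop, ω n = v) (hμ : μ ≠ 0) :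
    ¬ Summable fun n => μ.real {ω | ω n = v} := fun hs => by
  have htsum : ∑' n, μ {ω : PathSpace V | ω n = v} ≠ ⊤ := by
    simpa only [ofReal_measureReal (measure_ne_top _ _)] using hs.tsum_ofReal_ne_top
  have hnever : ∀ᵐ ω ∂μ, ¬ ∃ᶠ n in atTop, ω n = v :=
    measure_eq_zero_iff_ae_notMem.1 (measure_setOfPred_frequently_eq_zero htsum)
  have : (ae μ).NeBot := ae_neBot.2 hμ
  obtain ⟨ω, hω, hω'⟩ := (hvisit.and hnever).exists
  exact hω' hω

end Walks

/-! ### Electrical networks -/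

section Networks

variable {V : Type*} {G : SimpleGraph V} {c : V → V → ℝ} {f g : V → ℝ} {S : Finset V}

/-- The function `c` assigns a positive symmetric conductance to every edge of the graph `G`; it is
extended by `0` to the other pairs of vertices. -/
structure IsConductance (G : SimpleGraph V) (c : V → V → ℝ) : Prop where
  symm : ∀ v w, c v w = c w v
  pos : ∀ {v w}, G.Adj v w → 0 < c v w
  eq_zero : ∀ {v w}, ¬ G.Adj v w → c v w = 0

theorem IsConductance.nonneg (hc : IsConductance G c) (v w : V) : 0 ≤ c v w := by
  by_cases h : G.Adj v w
  · exact (hc.pos h).le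
  · exact (hc.eq_zero h).ge

open Classical in
/-- The network on `G` with all conductances equal to `1`. -/
def unitConductance (G : SimpleGraph V) (v w : V) : ℝ := if G.Adj v w then 1 else 0

theorem unitConductance_of_adj {v w : V} (h : G.Adj v w) : unitConductance G v w = 1 := if_pos h

theorem isConductance_unit (G : SimpleGraph V) : IsConductance G (unitConductance G) where
  symm v w := by classical exact if_congr (G.adj_comm v w) rfl rfl
  pos h := by simp [unitConductance_of_adj h]
  eq_zero h := if_neg h

/-- The Dirichlet energy of `f` over the ordered pairs of vertices of `S`, so that every edge counts
twice. -/
def energy (c : V → V → ℝ) (S : Finset V) (f : V → ℝ) : ℝ :=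
  ∑ v ∈ S, ∑ w ∈ S, c v w * (f v - f w) ^ 2

/-- The Laplacian of the network `c` on `G`, with the sign that makes it a nonnegative operator. -/
def laplacian (G : SimpleGraph V) [G.LocallyFinite] (c : V → V → ℝ) (f : V → ℝ) (v : V) : ℝ :=
  ∑ w ∈ G.neighborFinset v, c v w * (f v - f w)

theorem energy_mono (hc : ∀ v w, 0 ≤ c v w) {T : Finset V} (h : S ⊆ T) (f : V → ℝ) :
    energy c S f ≤ energy c T f := by
  have hterm : ∀ v w, 0 ≤ c v w * (f v - f w) ^ 2 := fun v w => mul_nonneg (hc v w) (sq_nonneg _)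
  calc energy c S f ≤ ∑ v ∈ S, ∑ w ∈ T, c v w * (f v - f w) ^ 2 :=
        Finset.sum_le_sum fun v _ => Finset.sum_le_sum_of_subset_of_nonneg h fun w _ _ => hterm v w
    _ ≤ energy c T f :=
        Finset.sum_le_sum_of_subset_of_nonneg h fun v _ _ => Finset.sum_nonneg fun w _ => hterm v w

theorem single_le_sum_sum {F : V → V → ℝ} (hF : ∀ v w, 0 ≤ F v w) {v w : V} (hv : v ∈ S)
    (hw : w ∈ S) : F v w ≤ ∑ v ∈ S, ∑ w ∈ S, F v w :=
  (Finset.single_le_sum (fun w _ => hF v w) hw).trans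
    (Finset.single_le_sum (f := fun v => ∑ w ∈ S, F v w)
      (fun v _ => Finset.sum_nonneg fun w _ => hF v w) hv)

theorem energy_le_mul_energy_unit (hc : IsConductance G c) {M : ℝ} (hM : ∀ v w, c v w ≤ M)
    (S : Finset V) (f : V → ℝ) : energy c S f ≤ M * energy (unitConductance G) S f := by
  simp only [energy, Finset.mul_sum]
  refine Finset.sum_le_sum fun v _ => Finset.sum_le_sum fun w _ => ?_
  by_cases h : G.Adj v w
  · rw [unitConductance_of_adj h, one_mul]
    exact mul_le_mul_of_nonneg_right (hM v w) (sq_nonneg _)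
  · simp [hc.eq_zero h, (isConductance_unit G).eq_zero h]

/-- There are finitely supported functions of arbitrarily small Dirichlet energy with value `1` at
the vertex `a`. -/
def HasNullCapacity (G : SimpleGraph V) (a : V) : Prop :=
  ∀ ε > 0, ∃ f : V → ℝ, (Function.support f).Finite ∧ f a = 1 ∧
    ∀ S, energy (unitConductance G) S f ≤ ε

theorem HasNullCapacity.exists_seq {u : V} (hu : HasNullCapacity G u) :
    ∃ f : ℕ → V → ℝ, (∀ n, (Function.support (f n)).Finite) ∧ (∀ n, f n u = 1) ∧
      (∀ n S, energy (unitConductance G) S (f n) ≤ 1 / ((n : ℝ) + 1)) ∧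
      ∀ v, G.Adj u v → Tendsto (fun n => f n v) atTop (nhds 1) := by
  choose f hfin hfu henergy using fun n : ℕ => hu (1 / ((n : ℝ) + 1)) (by positivity)
  refine ⟨f, hfin, hfu, henergy, fun v huv => ?_⟩
  have hsq : ∀ n, (f n v - 1) ^ 2 ≤ 1 / ((n : ℝ) + 1) := fun n => by
    classical
    have hle := single_le_sum_sum (S := {u, v})
      (F := fun v w => unitConductance G v w * (f n v - f n w) ^ 2)
      (fun v w => mul_nonneg ((isConductance_unit G).nonneg v w) (sq_nonneg _))
      (show v ∈ {u, v} by simp) (show u ∈ {u, v} by simp)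
    rw [unitConductance_of_adj huv.symm, hfu, one_mul] at hle
    exact hle.trans (henergy n _)
  have hsq_zero : Tendsto (fun n => (f n v - 1) ^ 2) atTop (nhds 0) :=
    squeeze_zero (fun n => sq_nonneg _) hsq tendsto_one_div_add_atTop_nhds_zero_nat
  have habs : Tendsto (fun n => |f n v - 1|) atTop (nhds 0) := by
    simpa only [Real.sqrt_sq_eq_abs, Real.sqrt_zero] using hsq_zero.sqrt
  simpa using ((tendsto_zero_iff_abs_tendsto_zero _).2 habs).add_const 1

variable [G.LocallyFinite]

theorem exists_finset_neighborFinset_subset (hf : (Function.support f).Finite) (S : Finset V) :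
    ∃ T, S ⊆ T ∧ ∀ v ∈ Function.support f, v ∈ T ∧ G.neighborFinset v ⊆ T := by
  classical
  refine ⟨S ∪ (hf.toFinset ∪ hf.toFinset.biUnion fun v => G.neighborFinset v),
    Finset.subset_union_left, fun v hv => ?_⟩
  have hv' : v ∈ hf.toFinset := hf.mem_toFinset.2 hv
  exact ⟨by simp [hv'], (Finset.subset_biUnion_of_mem (fun v => G.neighborFinset v) hv').trans
    (Finset.subset_union_right.trans Finset.subset_union_right)⟩

theorem IsConductance.sum_eq_laplacian (hc : IsConductance G c) (k : V → ℝ) {v : V}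
    (h : G.neighborFinset v ⊆ S) : ∑ w ∈ S, c v w * (k v - k w) = laplacian G c k v :=
  (Finset.sum_subset h fun w _ hw => by
    rw [hc.eq_zero (by simpa using hw), zero_mul]).symm

theorem IsConductance.green_identity (hc : IsConductance G c) (k : V → ℝ)
    (hS : ∀ v ∈ Function.support f, v ∈ S ∧ G.neighborFinset v ⊆ S) :
    ∑ v ∈ S, ∑ w ∈ S, c v w * ((f v - f w) * (k v - k w)) =
      2 * ∑ v ∈ S, f v * laplacian G c k v := by
  have hswap : ∑ v ∈ S, ∑ w ∈ S, c v w * (f w * (k v - k w)) =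
      -∑ v ∈ S, ∑ w ∈ S, c v w * (f v * (k v - k w)) := by
    rw [Finset.sum_comm]
    simp only [← Finset.sum_neg_distrib]
    refine Finset.sum_congr rfl fun v _ => Finset.sum_congr rfl fun w _ => ?_
    rw [hc.symm w v]
    ring
  calc ∑ v ∈ S, ∑ w ∈ S, c v w * ((f v - f w) * (k v - k w))
      = ∑ v ∈ S, ∑ w ∈ S, c v w * (f v * (k v - k w)) -
          ∑ v ∈ S, ∑ w ∈ S, c v w * (f w * (k v - k w)) := by
        simp only [← Finset.sum_sub_distrib]
        exact Finset.sum_congr rfl fun v _ => Finset.sum_congr rfl fun w _ => by ring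
    _ = 2 * ∑ v ∈ S, f v * ∑ w ∈ S, c v w * (k v - k w) := by
        rw [hswap, sub_neg_eq_add, ← two_mul]
        simp only [Finset.mul_sum]
        exact Finset.sum_congr rfl fun v _ => Finset.sum_congr rfl fun w _ => by ring
    _ = 2 * ∑ v ∈ S, f v * laplacian G c k v := by
        refine congrArg _ (Finset.sum_congr rfl fun v _ => ?_)
        rcases eq_or_ne (f v) 0 with hv | hv
        · rw [hv, zero_mul, zero_mul]
        · rw [hc.sum_eq_laplacian k (hS v hv).2]

theorem IsConductance.energy_eq (hc : IsConductance G c)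
    (hS : ∀ v ∈ Function.support f, v ∈ S ∧ G.neighborFinset v ⊆ S) :
    energy c S f = 2 * ∑ v ∈ S, f v * laplacian G c f v := by
  rw [← hc.green_identity f hS]
  simp only [energy, sq]

/-- Jacobi's ground state identity
`(f v - f w)² = (g v - g w) (f v² / g v - f w² / g w) + g v g w (f v / g v - f w / g w)²`, summed
over the edges. -/
theorem IsConductance.energy_eq_add (hc : IsConductance G c) (hg : ∀ v, 0 < g v)
    (hS : ∀ v ∈ Function.support f, v ∈ S ∧ G.neighborFinset v ⊆ S) :
    energy c S f = 2 * ∑ v ∈ S, f v ^ 2 / g v * laplacian G c g v +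
      ∑ v ∈ S, ∑ w ∈ S, c v w * (g v * g w * (f v / g v - f w / g w) ^ 2) := by
  have hsupp : ∀ v ∈ Function.support fun v => f v ^ 2 / g v,
      v ∈ S ∧ G.neighborFinset v ⊆ S := fun v hv => hS v fun h => hv (by simp [h])
  rw [← hc.green_identity g hsupp]
  simp only [energy, ← Finset.sum_add_distrib]
  refine Finset.sum_congr rfl fun v _ => Finset.sum_congr rfl fun w _ => ?_
  have := (hg v).ne'
  have := (hg w).ne'
  field_simp
  ring

theorem IsConductance.mul_sq_sub_le_energy (hc : IsConductance G c) (hg : ∀ v, 0 < g v)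
    (hsuper : ∀ v, 0 ≤ laplacian G c g v)
    (hS : ∀ v ∈ Function.support f, v ∈ S ∧ G.neighborFinset v ⊆ S) {u v : V} (hu : u ∈ S)
    (hv : v ∈ S) : c u v * (g u * g v * (f u / g u - f v / g v) ^ 2) ≤ energy c S f := by
  rw [hc.energy_eq_add hg hS]
  have hlaplacian : 0 ≤ ∑ v ∈ S, f v ^ 2 / g v * laplacian G c g v :=
    Finset.sum_nonneg fun v _ => mul_nonneg (div_nonneg (sq_nonneg _) (hg v).le) (hsuper v)
  have hterm := single_le_sum_sum
    (F := fun v w => c v w * (g v * g w * (f v / g v - f w / g w) ^ 2))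
    (fun v w => mul_nonneg (hc.nonneg v w)
      (mul_nonneg (mul_pos (hg v) (hg w)).le (sq_nonneg _))) hu hv
  linarith

theorem IsConductance.superharmonic_eq_of_adj (hc : IsConductance G c) {M : ℝ}
    (hM : ∀ v w, c v w ≤ M) (hg : ∀ v, 0 < g v) (hsuper : ∀ v, 0 ≤ laplacian G c g v) {u v : V}
    (hu : HasNullCapacity G u) (huv : G.Adj u v) : g u = g v := by
  classical
  obtain ⟨f, hfin, hfu, henergy, hone⟩ := hu.exists_seq
  have hle : ∀ n, c u v * (g u * g v * (f n u / g u - f n v / g v) ^ 2) ≤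
      M * (1 / ((n : ℝ) + 1)) := fun n => by
    obtain ⟨S, huS, hS⟩ := exists_finset_neighborFinset_subset (G := G) (hfin n) {u, v}
    calc _ ≤ energy c S (f n) :=
          hc.mul_sq_sub_le_energy hg hsuper hS (huS (by simp)) (huS (by simp))
      _ ≤ M * energy (unitConductance G) S (f n) := energy_le_mul_energy_unit hc hM S (f n)
      _ ≤ M * (1 / ((n : ℝ) + 1)) :=
          mul_le_mul_of_nonneg_left (henergy n S) ((hc.nonneg u v).trans (hM u v))
  simp only [hfu] at hle
  have hbound : Tendsto (fun n : ℕ => M * (1 / ((n : ℝ) + 1))) atTop (nhds 0) := by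
    simpa using tendsto_one_div_add_atTop_nhds_zero_nat.const_mul M
  have hzero := squeeze_zero (fun n => mul_nonneg (hc.nonneg u v)
    (mul_nonneg (mul_pos (hg u) (hg v)).le (sq_nonneg _))) hle hbound
  have hlimit := tendsto_nhds_unique hzero
    ((((((hone v huv).div_const (g v)).const_sub (1 / g u)).pow 2).const_mul (g u * g v)).const_mul
      (c u v))
  have hdiff : 1 / g u - 1 / g v = 0 := by
    simpa [(hc.pos huv).ne', (hg u).ne', (hg v).ne'] using hlimit.symm
  exact inv_injective (by simpa only [one_div] using sub_eq_zero.1 hdiff)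

theorem superharmonic_const (hG : G.Preconnected) (hcap : ∀ u, HasNullCapacity G u)
    (hc : IsConductance G c) {M : ℝ} (hM : ∀ v w, c v w ≤ M) (hg : ∀ v, 0 < g v)
    (hsuper : ∀ v, 0 ≤ laplacian G c g v) (u v : V) : g u = g v := by
  obtain ⟨path⟩ := hG u v
  induction path with
  | nil => rfl
  | cons huv _ ih => exact (hc.superharmonic_eq_of_adj hM hg hsuper (hcap _) huv).trans ih

theorem subharmonic_const (hG : G.Preconnected) (hcap : ∀ u, HasNullCapacity G u)
    (hc : IsConductance G c) {M : ℝ} (hM : ∀ v w, c v w ≤ M) {B : ℝ} (hg : ∀ v, g v ≤ B)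
    (hsub : ∀ v, laplacian G c g v ≤ 0) (u v : V) : g u = g v := by
  have hneg : ∀ v, laplacian G c (fun v => B + 1 - g v) v = -laplacian G c g v := fun v => by
    simp only [laplacian, ← Finset.sum_neg_distrib]
    exact Finset.sum_congr rfl fun w _ => by ring
  have hconst := superharmonic_const hG hcap hc hM (g := fun v => B + 1 - g v)
    (fun v => by linarith [hg v]) (fun v => (hneg v).symm ▸ neg_nonneg.2 (hsub v)) u v
  exact sub_right_injective hconst

/-- The Green function of the simple random walk with law `μ`, run for `N` steps: the expected
number of visits to `v`, divided by the degree. -/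
def greenFunction (G : SimpleGraph V) [G.LocallyFinite] (μ : Measure (PathSpace V)) (N : ℕ)
    (v : V) : ℝ :=
  ∑ n ∈ Finset.range N, μ.real {ω | ω n = v} / G.degree v

variable {μ : Measure (PathSpace V)}

theorem greenFunction_nonneg (N : ℕ) (v : V) : 0 ≤ greenFunction G μ N v :=
  Finset.sum_nonneg fun _ _ => by positivity

theorem IsWalkLaw.finite_support_greenFunction [Countable V] {a : V}
    (h : IsWalkLaw (simpleTransition G) a μ) (N : ℕ) :
    (Function.support (greenFunction G μ N)).Finite := by
  refine ((Finset.range N).finite_toSet.biUnion fun n _ => h.finite_support_measureReal n).subset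
    fun v hv => ?_
  obtain ⟨n, hn, hne⟩ := Finset.exists_ne_zero_of_sum_ne_zero hv
  exact Set.mem_biUnion hn (div_ne_zero_iff.1 hne).1

theorem IsWalkLaw.laplacian_greenFunction [Countable V] {a : V}
    (h : IsWalkLaw (simpleTransition G) a μ) (N : ℕ) {v : V} (hv : 0 < G.degree v) :
    laplacian G (unitConductance G) (greenFunction G μ N) v =
      μ.real {ω | ω 0 = v} - μ.real {ω | ω N = v} := by
  have hdeg : (G.degree v : ℝ) ≠ 0 := by positivity
  calc laplacian G (unitConductance G) (greenFunction G μ N) v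
      = G.degree v * greenFunction G μ N v - ∑ w ∈ G.neighborFinset v, greenFunction G μ N w := by
        rw [laplacian, ← SimpleGraph.card_neighborFinset_eq_degree, ← nsmul_eq_mul,
          ← Finset.sum_const, ← Finset.sum_sub_distrib]
        refine Finset.sum_congr rfl fun w hw => ?_
        rw [unitConductance_of_adj (by simpa using hw), one_mul]
    _ = ∑ n ∈ Finset.range N, (μ.real {ω | ω n = v} - μ.real {ω | ω (n + 1) = v}) := by
        simp only [greenFunction, h.measureReal_apply_succ, Finset.sum_sub_distrib, Finset.mul_sum]
        rw [Finset.sum_comm]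
        simp only [mul_div_cancel₀ _ hdeg]
    _ = μ.real {ω | ω 0 = v} - μ.real {ω | ω N = v} := Finset.sum_range_sub' _ N

theorem IsWalkLaw.energy_greenFunction_le [Countable V] {a : V}
    (h : IsWalkLaw (simpleTransition G) a μ) (hdeg : ∀ v, 0 < G.degree v) (N : ℕ) (S : Finset V) :
    energy (unitConductance G) S (greenFunction G μ N) ≤ 2 * greenFunction G μ N a := by
  classical
  obtain ⟨T, hST, hT⟩ :=
    exists_finset_neighborFinset_subset (G := G) (h.finite_support_greenFunction N) S
  refine (energy_mono (isConductance_unit G).nonneg hST _).trans ?_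
  rw [(isConductance_unit G).energy_eq hT]
  refine mul_le_mul_of_nonneg_left ?_ zero_le_two
  calc ∑ v ∈ T, greenFunction G μ N v *
        laplacian G (unitConductance G) (greenFunction G μ N) v
      ≤ ∑ v ∈ T, if v = a then greenFunction G μ N v else 0 := by
        refine Finset.sum_le_sum fun v _ => ?_
        rw [h.laplacian_greenFunction N (hdeg v), h.measureReal_start]
        have hg := greenFunction_nonneg (G := G) (μ := μ) N v
        have hq : 0 ≤ μ.real {ω | ω N = v} := measureReal_nonneg
        split_ifs <;> nlinarith
    _ ≤ greenFunction G μ N a := by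
        rw [Finset.sum_ite_eq']
        split_ifs
        exacts [le_rfl, greenFunction_nonneg N a]

theorem energy_div (c : V → V → ℝ) (S : Finset V) (f : V → ℝ) (r : ℝ) :
    energy c S (fun v => f v / r) = energy c S f / r ^ 2 := by
  simp only [energy, Finset.sum_div, ← sub_div, div_pow, mul_div_assoc]

theorem IsRecurrentGraph.hasNullCapacity (h : IsRecurrentGraph G) (a : V) :
    HasNullCapacity G a := by
  intro ε hε
  have : Countable V := IsRecurrentWalk.countable h
  obtain ⟨μ, hμ, hvisit⟩ := h a
  have := hμ.1
  have hdeg : ∀ v, 0 < G.degree v := fun v => (G.degree_pos_iff_exists_adj v).2 (h.exists_adj v)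
  have hgreen : Tendsto (fun N => greenFunction G μ N a) atTop atTop := by
    have hvisits := (not_summable_iff_tendsto_nat_atTop_of_nonneg fun n => measureReal_nonneg).1
      (not_summable_measureReal (hvisit.mono fun ω hω => hω a) (NeZero.ne μ))
    simp only [greenFunction, ← Finset.sum_div]
    exact hvisits.atTop_div_const (Nat.cast_pos.2 (hdeg a))
  obtain ⟨N, hN⟩ := (hgreen.eventually_ge_atTop (2 / ε)).exists
  have hpos : 0 < greenFunction G μ N a := (by positivity : 0 < 2 / ε).trans_le hN
  refine ⟨fun v => greenFunction G μ N v / greenFunction G μ N a,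
    (hμ.finite_support_greenFunction N).subset fun v hv => (div_ne_zero_iff.1 hv).1,
    div_self hpos.ne', fun S => ?_⟩
  calc energy (unitConductance G) S (fun v => greenFunction G μ N v / greenFunction G μ N a)
      ≤ 2 * greenFunction G μ N a / greenFunction G μ N a ^ 2 := by
        rw [energy_div]
        gcongr
        exact hμ.energy_greenFunction_le hdeg N S
    _ = 2 / greenFunction G μ N a := by field_simp
    _ ≤ ε := (div_le_comm₀ hε hpos).1 hN

end Networks

/-! ### Variation of angles -/

section Angles

variable {V : Type*} {ρ ρ' : V → ℝ} {Δ : Finset V} {v w : V}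

/-- For a triangle `Δ` of centers of mutually tangent circles of radii `ρ`, this is the radius of
the circle inscribed in it, by Heron's formula. -/
def inradius (ρ : V → ℝ) (Δ : Finset V) : ℝ := √((∏ u ∈ Δ, ρ u) / ∑ u ∈ Δ, ρ u)

theorem IsLabel.sum_pos (hρ : IsLabel ρ) (hΔ : Δ.Nonempty) : 0 < ∑ u ∈ Δ, ρ u :=
  Finset.sum_pos (fun u _ => hρ u) hΔ

theorem IsLabel.prod_pos (hρ : IsLabel ρ) (Δ : Finset V) : 0 < ∏ u ∈ Δ, ρ u :=
  Finset.prod_pos fun u _ => hρ u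

theorem inradius_pos (hρ : IsLabel ρ) (hΔ : Δ.Nonempty) : 0 < inradius ρ Δ :=
  Real.sqrt_pos.2 (div_pos (hρ.prod_pos Δ) (hρ.sum_pos hΔ))

theorem sq_inradius (hρ : IsLabel ρ) (hΔ : Δ.Nonempty) :
    inradius ρ Δ ^ 2 = (∏ u ∈ Δ, ρ u) / ∑ u ∈ Δ, ρ u :=
  Real.sq_sqrt (div_pos (hρ.prod_pos Δ) (hρ.sum_pos hΔ)).le

theorem sq_inradius_triple [DecidableEq V] (hρ : IsLabel ρ) {u : V} (hvw : v ≠ w) (hvu : v ≠ u)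
    (hwu : w ≠ u) :
    inradius ρ {v, w, u} ^ 2 = ρ v * ρ w * ρ u / (ρ v + ρ w + ρ u) := by
  have hv : v ∉ ({w, u} : Finset V) := by simp [hvw, hvu]
  rw [sq_inradius hρ (Finset.insert_nonempty _ _), Finset.prod_insert hv, Finset.sum_insert hv,
    Finset.prod_pair hwu, Finset.sum_pair hwu, mul_assoc, add_assoc]

theorem one_add_sq_inradius_div [DecidableEq V] (hρ : IsLabel ρ) {u : V} (hvw : v ≠ w)
    (hvu : v ≠ u) (hwu : w ≠ u) : 1 + (inradius ρ {v, w, u} / ρ v) ^ 2 =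
      (ρ v + ρ w) * (ρ v + ρ u) / (ρ v * (ρ v + ρ w + ρ u)) := by
  have := hρ v
  have := hρ w
  have := hρ u
  rw [div_pow, sq_inradius_triple hρ hvw hvu hwu]
  field_simp
  ring

/-- The bisector of the angle at `v` passes through the incenter, and the incircle touches the
sides at distance `ρ v` from `v`. -/
theorem angle_eq_two_mul_arctan (hρ : IsLabel ρ) (hΔ : Δ.card = 3) (hv : v ∈ Δ) :
    angle ρ v Δ = 2 * Real.arctan (inradius ρ Δ / ρ v) := by
  classical
  obtain ⟨w, hw, hvw⟩ := Finset.exists_mem_ne (by omega : 1 < Δ.card) v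
  obtain ⟨u, hvu, hwu, rfl⟩ := exists_eq_triple hΔ hv hw hvw.symm
  have hpos : 0 < inradius ρ {v, w, u} / ρ v := div_pos (inradius_pos hρ ⟨v, hv⟩) (hρ v)
  rw [← Real.arccos_cos (x := 2 * _) (by linarith [Real.arctan_pos.2 hpos])
    (by linarith [Real.arctan_lt_pi_div_two (inradius ρ {v, w, u} / ρ v)]), Real.cos_two_mul,
    Real.cos_sq_arctan, one_add_sq_inradius_div hρ hvw.symm hvu hwu, Finset.insert_comm,
    angle_eq ρ hvw hvu hwu]
  have := hρ v
  have := hρ w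
  have := hρ u
  congr 1
  field_simp
  ring

/-- The derivative of the angle at `v` of the triangle `Δ` with respect to `log (ρ w)`, where `w` is
another vertex of `Δ`. -/
def angleWeight (ρ : V → ℝ) (Δ : Finset V) (v w : V) : ℝ := inradius ρ Δ / (ρ v + ρ w)

section Curves

variable {σ : ℝ → V → ℝ} {h : V → ℝ} {t : ℝ}

theorem hasDerivAt_prod_label (hσ : ∀ u, HasDerivAt (fun s => σ s u) (σ t u * h u) t)
    (Δ : Finset V) :
    HasDerivAt (fun s => ∏ u ∈ Δ, σ s u) ((∏ u ∈ Δ, σ t u) * ∑ u ∈ Δ, h u) t := by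
  classical
  refine (HasDerivAt.fun_finsetProd fun u _ => hσ u).congr_deriv ?_
  rw [Finset.mul_sum]
  refine Finset.sum_congr rfl fun u hu => ?_
  rw [smul_eq_mul, ← mul_assoc, Finset.prod_erase_mul _ _ hu]

theorem hasDerivAt_inradius (hpos : IsLabel (σ t)) (hΔ : Δ.Nonempty)
    (hσ : ∀ u, HasDerivAt (fun s => σ s u) (σ t u * h u) t) :
    HasDerivAt (fun s => inradius (σ s) Δ)
      (inradius (σ t) Δ / 2 * (∑ u ∈ Δ, h u - (∑ u ∈ Δ, σ t u * h u) / ∑ u ∈ Δ, σ t u)) t := by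
  have hsum := (hpos.sum_pos hΔ).ne'
  have hr := inradius_pos hpos hΔ
  refine (((hasDerivAt_prod_label hσ Δ).fun_div (HasDerivAt.fun_sum fun u _ => hσ u) hsum).sqrt
    (div_pos (hpos.prod_pos Δ) (hpos.sum_pos hΔ)).ne').congr_deriv ?_
  change _ / (2 * inradius (σ t) Δ) = _
  rw [div_eq_iff (by positivity), show ∀ r x : ℝ, r / 2 * x * (2 * r) = r ^ 2 * x by intros; ring,
    sq_inradius hpos hΔ]
  field_simp

open Classical in
theorem hasDerivAt_angle (hpos : ∀ s, IsLabel (σ s)) (hΔ : Δ.card = 3) (hv : v ∈ Δ)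
    (hσ : ∀ u, HasDerivAt (fun s => σ s u) (σ t u * h u) t) :
    HasDerivAt (fun s => angle (σ s) v Δ)
      (∑ w ∈ Δ.erase v, angleWeight (σ t) Δ v w * (h w - h v)) t := by
  obtain ⟨w, hw, hwv⟩ := Finset.exists_mem_ne (by omega : 1 < Δ.card) v
  obtain ⟨u, hvu, hwu, rfl⟩ := exists_eq_triple hΔ hv hw hwv.symm
  have hmem : v ∉ ({w, u} : Finset V) := by simp [hwv.symm, hvu]
  simp only [fun s => angle_eq_two_mul_arctan (hpos s) hΔ hv]
  refine (((hasDerivAt_inradius (hpos t) ⟨v, hv⟩ hσ).fun_div (hσ v)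
    (hpos t v).ne').arctan.const_mul 2).congr_deriv ?_
  rw [one_add_sq_inradius_div (hpos t) hwv.symm hvu hwu, Finset.erase_insert hmem,
    Finset.sum_pair hwu]
  simp only [Finset.sum_insert hmem, Finset.sum_pair hwu, angleWeight]
  have := hpos t v
  have := hpos t w
  have := hpos t u
  field_simp
  ring

end Curves

theorem angleWeight_comm (ρ : V → ℝ) (Δ : Finset V) (v w : V) :
    angleWeight ρ Δ v w = angleWeight ρ Δ w v := by
  rw [angleWeight, angleWeight, add_comm]

theorem angleWeight_pos (hρ : IsLabel ρ) (hΔ : Δ.Nonempty) (v w : V) : 0 < angleWeight ρ Δ v w :=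
  div_pos (inradius_pos hρ hΔ) (add_pos (hρ v) (hρ w))

theorem angleWeight_le (hρ : IsLabel ρ) (hΔ : Δ.card = 3) (hv : v ∈ Δ) (hw : w ∈ Δ)
    (hvw : v ≠ w) : angleWeight ρ Δ v w ≤ 1 / 2 := by
  classical
  obtain ⟨u, hvu, hwu, rfl⟩ := exists_eq_triple hΔ hv hw hvw
  have hρv := hρ v
  have hρw := hρ w
  have hρu := hρ u
  rw [angleWeight, div_le_iff₀ (add_pos hρv hρw)]
  refine le_of_sq_le_sq ?_ (by positivity)
  calc inradius ρ {v, w, u} ^ 2 = ρ v * ρ w * (ρ u / (ρ v + ρ w + ρ u)) := by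
        rw [sq_inradius_triple hρ hvw hvu hwu, mul_div_assoc]
    _ ≤ ρ v * ρ w := mul_le_of_le_one_right (by positivity)
        (div_le_one_of_le₀ (by linarith) (by positivity))
    _ ≤ (1 / 2 * (ρ v + ρ w)) ^ 2 := by linarith [four_mul_le_sq_add (ρ v) (ρ w)]

/-- The geometric interpolation from the label `ρ` at time `0` to the label `ρ'` at time `1`, whose
logarithm is affine in `t`. -/
def interpolate (ρ ρ' : V → ℝ) (t : ℝ) (v : V) : ℝ := ρ v * (ρ' v / ρ v) ^ t

theorem interpolate_zero (ρ ρ' : V → ℝ) : interpolate ρ ρ' 0 = ρ := by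
  funext v
  rw [interpolate, Real.rpow_zero, mul_one]

theorem interpolate_one (hρ : IsLabel ρ) (ρ' : V → ℝ) : interpolate ρ ρ' 1 = ρ' := by
  funext v
  rw [interpolate, Real.rpow_one, mul_div_cancel₀ _ (hρ v).ne']

theorem isLabel_interpolate (hρ : IsLabel ρ) (hρ' : IsLabel ρ') (t : ℝ) :
    IsLabel (interpolate ρ ρ' t) := fun v =>
  mul_pos (hρ v) (Real.rpow_pos_of_pos (div_pos (hρ' v) (hρ v)) t)

theorem hasDerivAt_interpolate (hρ : IsLabel ρ) (hρ' : IsLabel ρ') (v : V) (t : ℝ) :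
    HasDerivAt (fun s => interpolate ρ ρ' s v)
      (interpolate ρ ρ' t v * Real.log (ρ' v / ρ v)) t :=
  (((hasDerivAt_id t).const_rpow (div_pos (hρ' v) (hρ v))).const_mul (ρ v)).congr_deriv (by
    simp only [interpolate, id]
    ring)

theorem continuous_angleWeight_interpolate (hρ : IsLabel ρ) (hρ' : IsLabel ρ') (hΔ : Δ.Nonempty)
    (v w : V) : Continuous fun t => angleWeight (interpolate ρ ρ' t) Δ v w := by
  have hpos := isLabel_interpolate hρ hρ'
  have hcont : ∀ u, Continuous fun t => interpolate ρ ρ' t u := fun u =>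
    continuous_iff_continuousAt.2 fun t => (hasDerivAt_interpolate hρ hρ' u t).continuousAt
  have hinradius : Continuous fun t => inradius (interpolate ρ ρ' t) Δ :=
    continuous_iff_continuousAt.2 fun t =>
      (hasDerivAt_inradius (hpos t) hΔ fun u => hasDerivAt_interpolate hρ hρ' u t).continuousAt
  exact hinradius.div ((hcont v).add (hcont w)) fun t => (add_pos (hpos t v) (hpos t w)).ne'

/-- The contribution of the triangle `Δ` to the conductance of the edge `{v, w}`. -/
def angleConductance (ρ ρ' : V → ℝ) (Δ : Finset V) (v w : V) : ℝ :=
  ∫ t in (0 : ℝ)..1, angleWeight (interpolate ρ ρ' t) Δ v w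

theorem angleConductance_comm (ρ ρ' : V → ℝ) (Δ : Finset V) (v w : V) :
    angleConductance ρ ρ' Δ v w = angleConductance ρ ρ' Δ w v := by
  simp only [angleConductance, angleWeight_comm _ Δ v w]

theorem angleConductance_pos (hρ : IsLabel ρ) (hρ' : IsLabel ρ') (hΔ : Δ.Nonempty) (v w : V) :
    0 < angleConductance ρ ρ' Δ v w :=
  intervalIntegral.intervalIntegral_pos_of_pos
    ((continuous_angleWeight_interpolate hρ hρ' hΔ v w).intervalIntegrable _ _)
    (fun t => angleWeight_pos (isLabel_interpolate hρ hρ' t) hΔ v w) one_pos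

theorem angleConductance_le (hρ : IsLabel ρ) (hρ' : IsLabel ρ') (hΔ : Δ.card = 3) (hv : v ∈ Δ)
    (hw : w ∈ Δ) (hvw : v ≠ w) : angleConductance ρ ρ' Δ v w ≤ 1 / 2 :=
  calc angleConductance ρ ρ' Δ v w ≤ ∫ _ in (0 : ℝ)..1, (1 / 2 : ℝ) :=
        intervalIntegral.integral_mono_on zero_le_one
          ((continuous_angleWeight_interpolate hρ hρ' ⟨v, hv⟩ v w).intervalIntegrable _ _)
          intervalIntegrable_const
          fun t _ => angleWeight_le (isLabel_interpolate hρ hρ' t) hΔ hv hw hvw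
    _ = 1 / 2 := by simp

open Classical in
theorem angle_sub_angle (hρ : IsLabel ρ) (hρ' : IsLabel ρ') (hΔ : Δ.card = 3) (hv : v ∈ Δ) :
    angle ρ' v Δ - angle ρ v Δ = ∑ w ∈ Δ.erase v,
      angleConductance ρ ρ' Δ v w * (Real.log (ρ' w / ρ w) - Real.log (ρ' v / ρ v)) := by
  have hint : ∀ w, IntervalIntegrable (fun t => angleWeight (interpolate ρ ρ' t) Δ v w *
      (Real.log (ρ' w / ρ w) - Real.log (ρ' v / ρ v))) volume 0 1 := fun w =>
    ((continuous_angleWeight_interpolate hρ hρ' ⟨v, hv⟩ v w).mul_const _).intervalIntegrable _ _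
  have hftc := intervalIntegral.integral_eq_sub_of_hasDerivAt (a := 0) (b := 1)
    (fun t _ => hasDerivAt_angle (isLabel_interpolate hρ hρ') hΔ hv
      fun u => hasDerivAt_interpolate hρ hρ' u t)
    (by simpa only [Finset.sum_fn] using IntervalIntegrable.sum _ fun w _ => hint w)
  rw [interpolate_zero, interpolate_one hρ] at hftc
  rw [← hftc, intervalIntegral.integral_finsetSum fun w _ => hint w]
  simp only [intervalIntegral.integral_mul_const, angleConductance]

end Angles

/-! ### The network of a pair of labels -/

section Comparison

variable {V : Type*} {K : AbstractSimplicialComplex V} {ρ ρ' : V → ℝ} {v w : V}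

/-- The conductance of an edge: the total contribution of the triangles that contain it. If there
are infinitely many of them, the value is `0`. -/
def labelConductance (K : AbstractSimplicialComplex V) (ρ ρ' : V → ℝ) (v w : V) : ℝ :=
  ∑ᶠ Δ ∈ edgeTriangles K v w, angleConductance ρ ρ' Δ v w

theorem labelConductance_eq_sum {T : Finset (Finset V)} (hT : T = edgeTriangles K v w) :
    labelConductance K ρ ρ' v w = ∑ Δ ∈ T, angleConductance ρ ρ' Δ v w := by
  rw [labelConductance, ← hT, finsum_mem_coe_finset]

theorem isConductance_labelConductance
    (hne : ∀ v w, (oneSkeleton K).Adj v w → (edgeTriangles K v w).Nonempty)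
    (hfin : ∀ v w, (edgeTriangles K v w).Finite) (hρ : IsLabel ρ) (hρ' : IsLabel ρ') :
    IsConductance (oneSkeleton K) (labelConductance K ρ ρ') where
  symm v w := by
    simp only [labelConductance, edgeTriangles_comm v w, angleConductance_comm ρ ρ' _ v w]
  pos {v w} hvw := by
    rw [labelConductance_eq_sum (hfin v w).coe_toFinset]
    refine Finset.sum_pos (fun Δ hΔ => ?_) ((hfin v w).toFinset_nonempty.2 (hne v w hvw))
    obtain ⟨-, -, hv, -⟩ := (hfin v w).mem_toFinset.1 hΔ
    exact angleConductance_pos hρ hρ' ⟨v, hv⟩ v w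
  eq_zero {v w} hvw := by
    have hempty : edgeTriangles K v w = ∅ := Set.eq_empty_of_forall_notMem
      fun Δ ⟨hΔ, _, hv, hw, hne⟩ => hvw (oneSkeleton_adj_of_mem hΔ hv hw hne)
    rw [labelConductance, hempty, finsum_mem_empty]

theorem labelConductance_le (hρ : IsLabel ρ) (hρ' : IsLabel ρ') {N : ℕ}
    (hN : (edgeTriangles K v w).encard ≤ N) : labelConductance K ρ ρ' v w ≤ N / 2 := by
  have hfin := Set.finite_of_encard_le_coe hN
  have hcard : hfin.toFinset.card ≤ N := by
    rwa [hfin.encard_eq_coe_toFinset_card, Nat.cast_le] at hN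
  rw [labelConductance_eq_sum hfin.coe_toFinset]
  calc ∑ Δ ∈ hfin.toFinset, angleConductance ρ ρ' Δ v w
      ≤ hfin.toFinset.card • (1 / 2 : ℝ) := Finset.sum_le_card_nsmul _ _ _ fun Δ hΔ => by
        obtain ⟨-, h3, hv, hw, hne⟩ := hfin.mem_toFinset.1 hΔ
        exact angleConductance_le hρ hρ' h3 hv hw hne
    _ ≤ N / 2 := by
        rw [nsmul_eq_mul, mul_one_div]
        gcongr

variable [(oneSkeleton K).LocallyFinite]

theorem finite_triangles (v : V) : {Δ | Δ ∈ K.faces ∧ Δ.card = 3 ∧ v ∈ Δ}.Finite := by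
  classical
  refine (insert v ((oneSkeleton K).neighborFinset v)).powerset.finite_toSet.subset ?_
  rintro Δ ⟨hΔ, -, hv⟩
  refine Finset.mem_powerset.2 fun w hw => Finset.mem_insert.2 (or_iff_not_imp_left.2 fun hwv => ?_)
  exact ((oneSkeleton K).mem_neighborFinset v w).2 (oneSkeleton_adj_of_mem hΔ hv hw (Ne.symm hwv))

theorem angleSum_eq_sum (ρ : V → ℝ) (v : V) :
    angleSum K ρ v = ∑ Δ ∈ (finite_triangles (K := K) v).toFinset, angle ρ v Δ :=
  finsum_mem_eq_finite_toFinset_sum _ (finite_triangles v)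

theorem laplacian_log_ratio (hρ : IsLabel ρ) (hρ' : IsLabel ρ') (v : V) :
    laplacian (oneSkeleton K) (labelConductance K ρ ρ') (fun u => Real.log (ρ' u / ρ u)) v =
      angleSum K ρ v - angleSum K ρ' v := by
  classical
  set T := (finite_triangles (K := K) v).toFinset with hT
  have hmem : ∀ {Δ}, Δ ∈ T ↔ Δ ∈ K.faces ∧ Δ.card = 3 ∧ v ∈ Δ :=
    Set.Finite.mem_toFinset _
  have hedge : ∀ w ∈ (oneSkeleton K).neighborFinset v,
      T.filter (fun Δ => w ∈ Δ) = edgeTriangles K v w := fun w hw => by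
    ext Δ
    have hvw : v ≠ w := (((oneSkeleton K).mem_neighborFinset v w).1 hw).ne
    simp [hmem, edgeTriangles, hvw, and_assoc]
  rw [← neg_sub, angleSum_eq_sum, angleSum_eq_sum, ← hT, ← Finset.sum_sub_distrib,
    ← Finset.sum_neg_distrib, laplacian]
  calc _ = ∑ w ∈ (oneSkeleton K).neighborFinset v, ∑ Δ ∈ T.filter (fun Δ => w ∈ Δ),
        angleConductance ρ ρ' Δ v w * (Real.log (ρ' v / ρ v) - Real.log (ρ' w / ρ w)) :=
        Finset.sum_congr rfl fun w hw => by
          rw [labelConductance_eq_sum (hedge w hw), Finset.sum_mul]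
    _ = ∑ Δ ∈ T, ∑ w ∈ Δ.erase v,
        angleConductance ρ ρ' Δ v w * (Real.log (ρ' v / ρ v) - Real.log (ρ' w / ρ w)) := by
        refine Finset.sum_comm' fun w Δ => ?_
        rw [Finset.mem_filter, Finset.mem_erase, SimpleGraph.mem_neighborFinset]
        refine ⟨fun ⟨hvw, hΔ, hw⟩ => ⟨⟨hvw.ne', hw⟩, hΔ⟩, fun ⟨⟨hwv, hw⟩, hΔ⟩ => ⟨?_, hΔ, hw⟩⟩
        obtain ⟨hface, -, hv⟩ := hmem.1 hΔ
        exact oneSkeleton_adj_of_mem hface hv hw hwv.symm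
    _ = _ := Finset.sum_congr rfl fun Δ hΔ => by
        obtain ⟨-, h3, hv⟩ := hmem.1 hΔ
        rw [angle_sub_angle hρ hρ' h3 hv, ← Finset.sum_neg_distrib]
        exact Finset.sum_congr rfl fun w _ => by ring

end Comparison

end LabelledComplex

end

open LabelledComplex in
theorem theorem3p1_general {V : Type*} {K : AbstractSimplicialComplex V} {N : ℕ}
    (hne : ∀ v w, (oneSkeleton K).Adj v w → (edgeTriangles K v w).Nonempty)
    (hle : ∀ v w, (edgeTriangles K v w).encard ≤ N) (hrec : IsRecurrentGraph (oneSkeleton K))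
    {ρ ρ' : V → ℝ} (hρ : IsLabel ρ) (hρ' : IsLabel ρ') (hsub : IsSubpacking K ρ' (angleSum K ρ)) :
    (∃ M : ℝ, ∀ v, ρ' v / ρ v ≤ M) ↔ ∃ c : ℝ, ∀ v, ρ' v / ρ v = c := by
  refine ⟨fun ⟨M, hM⟩ => ?_, fun ⟨c, hc⟩ => ⟨c, fun v => (hc v).le⟩⟩
  rcases isEmpty_or_nonempty V with hV | ⟨⟨a⟩⟩
  · exact ⟨0, hV.elim⟩
  have : (oneSkeleton K).LocallyFinite := fun v => (hrec.neighborSet_finite v).fintype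
  have hratio : ∀ v, 0 < ρ' v / ρ v := fun v => div_pos (hρ' v) (hρ v)
  have hconst := subharmonic_const hrec.reachable hrec.hasNullCapacity
    (isConductance_labelConductance hne (fun v w => Set.finite_of_encard_le_coe (hle v w)) hρ hρ')
    (fun v w => labelConductance_le hρ hρ' (hle v w))
    (fun v => Real.log_le_log (hratio v) (hM v))
    (fun v => (laplacian_log_ratio hρ hρ' v).trans_le (sub_nonpos.2 (hsub v)))
  exact ⟨ρ' a / ρ a, fun v => Real.log_injOn_pos (hratio v) (hratio a) (hconst v a)⟩

theorem theorem3p1 {V : Type*} (K : AbstractSimplicialComplex V) (D : Set ℂ)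
    (hD : IsOpen D) (hconn : IsConnected D)
    (hK : LabelledComplex.IsTriangulationOf K D)
    (hrec : LabelledComplex.IsRecurrentGraph (LabelledComplex.oneSkeleton K))
    (ρ ρ' : V → ℝ) (hρ : LabelledComplex.IsLabel ρ) (hρ' : LabelledComplex.IsLabel ρ')
    (hsub : LabelledComplex.IsSubpacking K ρ' (LabelledComplex.angleSum K ρ)) :
    (∃ M : ℝ, ∀ v, ρ' v / ρ v ≤ M) ↔ ∃ c : ℝ, ∀ v, ρ' v / ρ v = c := by
  obtain ⟨e, he⟩ := hK.exists_isOpenEmbedding hD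
  exact theorem3p1_general (N := 2) (fun _ _ => LabelledComplex.edgeTriangles_nonempty he)
    (LabelledComplex.encard_edgeTriangles_le_two he.continuous he.injective) hrec hρ hρ' hsub
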